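/- Let $$N^1=\Big\{\,p(x;\mu,\sigma)=\tfrac{1}{\sqrt{2\pi}\,\sigma}\exp\!\Big(-\tfrac{(x-\mu)^2}{2\sigma^2}\Big)\ :\ \mu\in\mathbb R,\ \sigma>0\Big\}$$ be the manifold of univariate normal distributions, a $2$-dimensional manifold with global coordinates $\theta=(\theta_1,\theta_2)=(\mu,\sigma)$, and let $g$ be its Fisher metric, $$g_{ij}(\theta)=\int_{\mathbb R}(\partial_i l)(\partial_j l)\,p(x;\theta)\,dx,\qquad l=\log p(x;\theta),\quad \partial_i=\partial/\partial\theta_i .$$ Let $\nabla$ be the Levi-Civita connection of $g$. For $\theta\in N^1$ let $$H_\theta=\{P_\gamma\in GL(T_\theta N^1)\ :\ \gamma:[0,1]\to N^1 \text{ a piecewise smooth loop based at }\theta\}$$ be the Riemannian holonomy group at $\theta$, where $P_\gamma$ is the $\nabla$-parallel transport along $\gamma$. Then $H_\theta=SO(2)$ for every $\theta\in N^1$. Precisely: $T_\theta N^1$ has a $g_\theta$-orthonormal basis, and with respect to every such basis the set of matrices of the elements of $H_\theta$ is exactly $SO(2)\subset GL(2,\mathbb R)$. -/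

import Mathlib

open scoped ContDiff Matrix

noncomputable section

namespace StatHolonomy

/-! ### Riemannian geometry on an open set of coordinates

A manifold covered by one coordinate system is identified with its coordinate domain `Θ ⊆ ℝⁿ`,
each tangent space being `ℝⁿ` with the coordinate basis `∂₁, …, ∂ₙ`. -/

/-- The partial derivative `∂ᵢ f` at `θ`. -/
def partialDeriv {n : ℕ} (i : Fin n) (f : (Fin n → ℝ) → ℝ) (θ : Fin n → ℝ) : ℝ :=
  lineDeriv ℝ f θ (Pi.single i 1)

/-- The connection coefficients `Γᵏᵢⱼ` (as `christoffel g θ k i j`) of the Levi-Civita connection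
of the metric `g = (gᵢⱼ)`, i.e. `∇_{∂ᵢ} ∂ⱼ = ∑ₖ Γᵏᵢⱼ ∂ₖ` with
`Γᵏᵢⱼ = ½ ∑ₗ gᵏˡ (∂ᵢ gⱼₗ + ∂ⱼ gᵢₗ - ∂ₗ gᵢⱼ)`. -/
def christoffel {n : ℕ} (g : (Fin n → ℝ) → Matrix (Fin n) (Fin n) ℝ) (θ : Fin n → ℝ)
    (k i j : Fin n) : ℝ :=
  (1 / 2 : ℝ) * ∑ l, (g θ)⁻¹ k l *
    (partialDeriv i (fun η => g η j l) θ + partialDeriv j (fun η => g η i l) θ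
      - partialDeriv l (fun η => g η i j) θ)

/-- A curve `γ : [0,1] → ℝⁿ` is piecewise smooth: `[0,1]` is a finite union of consecutive closed
intervals on each of which `γ` is smooth up to the end points (so `γ` is continuous on `[0,1]`).
Values of `γ` outside `[0,1]` are irrelevant. -/
def IsPiecewiseSmooth {n : ℕ} (γ : ℝ → Fin n → ℝ) : Prop :=
  ∃ (m : ℕ) (t : Fin (m + 1) → ℝ), StrictMono t ∧ t 0 = 0 ∧ t (Fin.last m) = 1 ∧
    ∀ i : Fin m, ContDiffOn ℝ ∞ γ (Set.Icc (t i.castSucc) (t i.succ))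

/-- `γ` is a piecewise smooth loop in `Θ` based at `θ₀`. -/
structure IsLoopAt {n : ℕ} (Θ : Set (Fin n → ℝ)) (θ₀ : Fin n → ℝ) (γ : ℝ → Fin n → ℝ) :
    Prop where
  piecewiseSmooth : IsPiecewiseSmooth γ
  mem : ∀ t ∈ Set.Icc (0 : ℝ) 1, γ t ∈ Θ
  source : γ 0 = θ₀
  target : γ 1 = θ₀

/-- The vector field `V` along the curve `γ : [0,1] → ℝⁿ` is parallel for the connection with
coefficients `Γ`: it is continuous on `[0,1]` and, at all but finitely many times, satisfies
`dVᵏ/dt + ∑ᵢⱼ Γᵏᵢⱼ(γ) (dγⁱ/dt) Vʲ = 0`. -/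
def IsParallelAlong {n : ℕ} (Γ : (Fin n → ℝ) → Fin n → Fin n → Fin n → ℝ)
    (γ V : ℝ → Fin n → ℝ) : Prop :=
  ContinuousOn V (Set.Icc 0 1) ∧
    ∃ S : Set ℝ, S.Finite ∧ ∀ t ∈ Set.Ioo (0 : ℝ) 1 \ S, ∀ k,
      HasDerivAt (fun s => V s k)
        (-∑ i, ∑ j, Γ (γ t) k i j * deriv (fun s => γ s i) t * V t j) t

/-- `P ∈ GL(n,ℝ)` is the parallel transport along `γ` from `γ 0` to `γ 1` (as a matrix with
respect to the coordinate bases): every `v` is the initial value of a parallel field along `γ`,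
with final value `P v`. -/
def IsParallelTransport {n : ℕ} (Γ : (Fin n → ℝ) → Fin n → Fin n → Fin n → ℝ)
    (γ : ℝ → Fin n → ℝ) (P : GL (Fin n) ℝ) : Prop :=
  ∀ v : Fin n → ℝ, ∃ V : ℝ → Fin n → ℝ, IsParallelAlong Γ γ V ∧ V 0 = v ∧
    V 1 = (P : Matrix (Fin n) (Fin n) ℝ) *ᵥ v

/-- The Riemannian holonomy group at `θ₀` of the metric `g` on `Θ`: all parallel transports of the
Levi-Civita connection along piecewise smooth loops in `Θ` based at `θ₀`, as matrices with
respect to the coordinate basis of the tangent space at `θ₀`. -/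
def riemannianHolonomy {n : ℕ} (Θ : Set (Fin n → ℝ))
    (g : (Fin n → ℝ) → Matrix (Fin n) (Fin n) ℝ) (θ₀ : Fin n → ℝ) : Set (GL (Fin n) ℝ) :=
  {P | ∃ γ, IsLoopAt Θ θ₀ γ ∧ IsParallelTransport (christoffel g) γ P}

/-- The columns of `F` form an orthonormal basis of the tangent space at `θ` for the metric `g`. -/
def IsOrthonormalFrame {n : ℕ} (g : (Fin n → ℝ) → Matrix (Fin n) (Fin n) ℝ) (θ : Fin n → ℝ)
    (F : GL (Fin n) ℝ) : Prop :=
  (F : Matrix (Fin n) (Fin n) ℝ)ᵀ * g θ * (F : Matrix (Fin n) (Fin n) ℝ) = 1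

/-! ### Statistical models -/

/-- The Fisher metric `gᵢⱼ(θ) = ∫ (∂ᵢ l)(∂ⱼ l) p(x;θ) dx`, `l = log p(x;θ)`, of a family of
densities `p` on `ℝ`, where `p θ x = p(x;θ)`. -/
def fisherMetric {n : ℕ} (p : (Fin n → ℝ) → ℝ → ℝ) (θ : Fin n → ℝ) :
    Matrix (Fin n) (Fin n) ℝ :=
  Matrix.of fun i j => ∫ x : ℝ,
    partialDeriv i (fun η => Real.log (p η x)) θ *
      partialDeriv j (fun η => Real.log (p η x)) θ * p θ x

/-- The parameter domain of the univariate normal family: `θ = (μ, σ)` with `σ > 0`. -/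
def normalDomain : Set (Fin 2 → ℝ) := {θ | 0 < θ 1}

/-- The density of the normal distribution with mean `μ = θ 0` and standard deviation
`σ = θ 1`. -/
def normalDensity (θ : Fin 2 → ℝ) (x : ℝ) : ℝ :=
  1 / (√(2 * Real.pi) * θ 1) * Real.exp (-(x - θ 0) ^ 2 / (2 * θ 1 ^ 2))

/-- On the parameter domain this is the usual Gaussian density with variance `σ²`. -/
theorem normalDensity_eq_gaussianPDFReal {θ : Fin 2 → ℝ} (hθ : θ ∈ normalDomain) (x : ℝ) :
    normalDensity θ x = ProbabilityTheory.gaussianPDFReal (θ 0) (Real.toNNReal (θ 1 ^ 2)) x := by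
  have h : (0 : ℝ) < θ 1 := hθ
  simp only [normalDensity, ProbabilityTheory.gaussianPDFReal, Real.coe_toNNReal _ (sq_nonneg _)]
  rw [Real.sqrt_mul (by positivity) (θ 1 ^ 2), Real.sqrt_sq h.le, one_div]

end StatHolonomy

end

namespace StatHolonomy

open MeasureTheory

/-! ### The Fisher metric of the normal family -/

/-! Gaussian moments up to order four give the metric `σ⁻² (dμ² + 2 dσ²)`, a rescaled hyperbolic
half-plane. Its parallel fields preserve both the metric and the area form (`parallel_invariants`);
around a loop the factors `σ⁻²` cancel, so every holonomy is an isometry of `diag(1, 2)` of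
determinant one.

Conversely, in the orthonormal frame `σ ∂μ, (σ/√2) ∂σ` a parallel field turns at rate `-μ' / (√2
σ)`. An explicit family of loops makes the total turning an arbitrary angle
(`mem_holonomy_of_entries`). Both inclusions use only given or explicit parallel fields, so ODE
existence and uniqueness theorems are not needed. Conjugation by an orthonormal frame carries the
isometry group of `g` to that of the identity form. -/

theorem hasDerivAt_normalDensity (θ : Fin 2 → ℝ) (x : ℝ) :
    HasDerivAt (normalDensity θ) (-(x - θ 0) / θ 1 ^ 2 * normalDensity θ x) x := by
  have h1 : HasDerivAt (fun x : ℝ => -(x - θ 0) ^ 2 / (2 * θ 1 ^ 2))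
      (-(2 * (x - θ 0)) / (2 * θ 1 ^ 2)) x := by
    have := ((((hasDerivAt_id x).sub_const (θ 0)).pow 2).neg).div_const (2 * θ 1 ^ 2)
    simpa using this
  have h2 := (h1.exp).const_mul (1 / (√(2 * Real.pi) * θ 1))
  refine h2.congr_deriv ?_
  rw [← mul_neg, mul_div_mul_left _ _ two_ne_zero, normalDensity]
  ring

theorem integrable_pow_mul_normalDensity {θ : Fin 2 → ℝ} (hθ : θ ∈ normalDomain) (n : ℕ) :
    Integrable (fun x : ℝ => (x - θ 0) ^ n * normalDensity θ x) := by
  have hσ : (0 : ℝ) < θ 1 := hθ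
  have hb : (0 : ℝ) < 1 / (2 * θ 1 ^ 2) := by positivity
  have h := integrable_rpow_mul_exp_neg_mul_sq hb (s := n)
    (lt_of_lt_of_le (by norm_num) (Nat.cast_nonneg n))
  have h' := (h.const_mul (1 / (√(2 * Real.pi) * θ 1))).comp_sub_right (θ 0)
  refine h'.congr (Filter.Eventually.of_forall fun x => ?_)
  simp only [normalDensity, Real.rpow_natCast]
  rw [show -(1 / (2 * θ 1 ^ 2)) * (x - θ 0) ^ 2 = -(x - θ 0) ^ 2 / (2 * θ 1 ^ 2) by ring]
  ring

theorem integral_normalDensity {θ : Fin 2 → ℝ} (hθ : θ ∈ normalDomain) :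
    ∫ x : ℝ, normalDensity θ x = 1 := by
  have hσ : (0 : ℝ) < θ 1 := hθ
  simp_rw [normalDensity_eq_gaussianPDFReal hθ]
  refine ProbabilityTheory.integral_gaussianPDFReal_eq_one _ ?_
  simp [Real.toNNReal_eq_zero, hσ.ne']

theorem integral_sub_mul_normalDensity {θ : Fin 2 → ℝ} (hθ : θ ∈ normalDomain) :
    ∫ x : ℝ, (x - θ 0) * normalDensity θ x = 0 := by
  have hσ : (0 : ℝ) < θ 1 := hθ
  have h1 := integrable_pow_mul_normalDensity hθ 1
  have h0 := integrable_pow_mul_normalDensity hθ 0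
  simp only [pow_one, pow_zero, one_mul] at h0 h1
  have h := integral_eq_zero_of_hasDerivAt_of_integrable (hasDerivAt_normalDensity θ)
    ((h1.const_mul (-(θ 1 ^ 2)⁻¹)).congr (Filter.Eventually.of_forall fun x => by ring)) h0
  have h2 : ∫ x : ℝ, -(x - θ 0) / θ 1 ^ 2 * normalDensity θ x
      = -(θ 1 ^ 2)⁻¹ * ∫ x : ℝ, (x - θ 0) * normalDensity θ x := by
    rw [← integral_const_mul]
    exact integral_congr_ae (Filter.Eventually.of_forall fun x => by ring)
  rw [h2] at h
  simpa [hσ.ne'] using h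

/-- Integration by parts: the derivative of `(x - μ)^(n+1) p` has integral zero, and `p' = -(x - μ)
p / σ²`. This recursion yields all moments needed for the metric. -/
theorem integral_pow_add_two_mul_normalDensity {θ : Fin 2 → ℝ} (hθ : θ ∈ normalDomain) (n : ℕ) :
    ∫ x : ℝ, (x - θ 0) ^ (n + 2) * normalDensity θ x
      = (n + 1) * θ 1 ^ 2 * ∫ x : ℝ, (x - θ 0) ^ n * normalDensity θ x := by
  have hσ : (0 : ℝ) < θ 1 := hθ
  have hd : ∀ x : ℝ, HasDerivAt (fun x => (x - θ 0) ^ (n + 1) * normalDensity θ x)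
      ((n + 1) * ((x - θ 0) ^ n * normalDensity θ x)
        - (θ 1 ^ 2)⁻¹ * ((x - θ 0) ^ (n + 2) * normalDensity θ x)) x := by
    intro x
    have h := (((hasDerivAt_id x).sub_const (θ 0)).pow (n + 1)).mul (hasDerivAt_normalDensity θ x)
    refine h.congr_deriv ?_
    simp
    ring
  have h0 := (integrable_pow_mul_normalDensity hθ n).const_mul (n + 1 : ℝ)
  have h2 := (integrable_pow_mul_normalDensity hθ (n + 2)).const_mul (θ 1 ^ 2)⁻¹
  have h := integral_eq_zero_of_hasDerivAt_of_integrable hd (h0.sub h2)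
    (integrable_pow_mul_normalDensity hθ (n + 1))
  rw [integral_sub h0 h2, integral_const_mul, integral_const_mul] at h
  field_simp at h
  linarith

theorem log_normalDensity {θ : Fin 2 → ℝ} (hθ : θ ∈ normalDomain) (x : ℝ) :
    Real.log (normalDensity θ x)
      = -Real.log √(2 * Real.pi) - Real.log (θ 1) - (x - θ 0) ^ 2 / (2 * θ 1 ^ 2) := by
  have hσ : (0 : ℝ) < θ 1 := hθ
  rw [normalDensity, Real.log_mul (by positivity) (Real.exp_pos _).ne', Real.log_exp, one_div,
    Real.log_inv, Real.log_mul (by positivity) hσ.ne']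
  ring

theorem isOpen_normalDomain : IsOpen normalDomain :=
  isOpen_lt continuous_const (continuous_apply 1)

/-- The closed formulas hold only for `σ > 0`; openness of that region allows differentiating them
there. -/
theorem partialDeriv_congr_of_isOpen {n : ℕ} {i : Fin n} {f f' : (Fin n → ℝ) → ℝ}
    {U : Set (Fin n → ℝ)} (hU : IsOpen U) (h : ∀ η ∈ U, f η = f' η) {θ : Fin n → ℝ} (hθ : θ ∈ U) :
    partialDeriv i f θ = partialDeriv i f' θ :=
  Filter.EventuallyEq.lineDeriv_eq (Filter.eventually_of_mem (hU.mem_nhds hθ) h)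

theorem partialDeriv_zero_log_normalDensity {θ : Fin 2 → ℝ} (hθ : θ ∈ normalDomain) (x : ℝ) :
    partialDeriv 0 (fun η => Real.log (normalDensity η x)) θ = (x - θ 0) / θ 1 ^ 2 := by
  rw [partialDeriv_congr_of_isOpen isOpen_normalDomain (fun η hη => log_normalDensity hη x) hθ]
  have hσ : (0 : ℝ) < θ 1 := hθ
  refine HasDerivAt.deriv ?_
  simp only [Pi.add_apply, Pi.smul_apply, Pi.single_apply, smul_eq_mul, if_true, one_ne_zero,
    if_false, mul_zero, add_zero, mul_one]
  have h := (((((hasDerivAt_id (0 : ℝ)).const_add (θ 0)).const_sub x).pow 2).div_const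
    (2 * θ 1 ^ 2)).const_sub (-Real.log √(2 * Real.pi) - Real.log (θ 1))
  refine h.congr_deriv ?_
  simp
  field_simp

theorem partialDeriv_one_log_normalDensity {θ : Fin 2 → ℝ} (hθ : θ ∈ normalDomain) (x : ℝ) :
    partialDeriv 1 (fun η => Real.log (normalDensity η x)) θ
      = -1 / θ 1 + (x - θ 0) ^ 2 / θ 1 ^ 3 := by
  rw [partialDeriv_congr_of_isOpen isOpen_normalDomain (fun η hη => log_normalDensity hη x) hθ]
  have hσ : (0 : ℝ) < θ 1 := hθ
  refine HasDerivAt.deriv ?_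
  simp only [Pi.add_apply, Pi.smul_apply, Pi.single_apply, smul_eq_mul, if_true, zero_ne_one,
    if_false, mul_zero, add_zero, mul_one]
  have hy := (hasDerivAt_id (0 : ℝ)).const_add (θ 1)
  have h := (((hy.log (by simpa using hσ.ne')).const_sub (-Real.log √(2 * Real.pi))).sub
    ((hasDerivAt_const (0 : ℝ) ((x - θ 0) ^ 2)).div ((hy.pow 2).const_mul 2)
      (by simpa using hσ.ne')))
  refine h.congr_deriv ?_
  simp
  field_simp
  ring

/-- The Fisher metric of the normal family is `σ⁻² (dμ² + 2 dσ²)`. -/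
theorem fisherMetric_normalDensity {θ : Fin 2 → ℝ} (hθ : θ ∈ normalDomain) :
    fisherMetric normalDensity θ = Matrix.of fun i j => !![1, 0; 0, 2] i j * (θ 1 ^ 2)⁻¹ := by
  have hσ : (0 : ℝ) < θ 1 := hθ
  have m0 := integral_normalDensity hθ
  have m1 := integral_sub_mul_normalDensity hθ
  have m2 := integral_pow_add_two_mul_normalDensity hθ 0
  have m3 := integral_pow_add_two_mul_normalDensity hθ 1
  have m4 := integral_pow_add_two_mul_normalDensity hθ 2
  have I0 := integrable_pow_mul_normalDensity hθ 0
  have I1 := integrable_pow_mul_normalDensity hθ 1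
  have I2 := integrable_pow_mul_normalDensity hθ 2
  have I3 := integrable_pow_mul_normalDensity hθ 3
  have I4 := integrable_pow_mul_normalDensity hθ 4
  norm_num [m0, m1] at m2 m3 I0 I1
  norm_num [m2] at m4
  -- The off-diagonal entry involves only odd central moments, which vanish.
  have h01 : ∫ x : ℝ, (x - θ 0) / θ 1 ^ 2 * (-1 / θ 1 + (x - θ 0) ^ 2 / θ 1 ^ 3)
      * normalDensity θ x = 0 := by
    rw [show (fun x : ℝ => (x - θ 0) / θ 1 ^ 2 * (-1 / θ 1 + (x - θ 0) ^ 2 / θ 1 ^ 3)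
      * normalDensity θ x) = fun x => (-1 / θ 1 ^ 3) * ((x - θ 0) * normalDensity θ x)
        + (1 / θ 1 ^ 5) * ((x - θ 0) ^ 3 * normalDensity θ x) by ext x; field_simp,
      integral_add (I1.const_mul _) (I3.const_mul _), integral_const_mul, integral_const_mul,
      m1, m3]
    ring
  ext i j
  fin_cases i <;> fin_cases j <;>
    simp only [fisherMetric, Matrix.of_apply, Fin.zero_eta, Fin.mk_one, Fin.isValue,
      partialDeriv_zero_log_normalDensity hθ, partialDeriv_one_log_normalDensity hθ,
      Matrix.cons_val_zero, Matrix.cons_val_one, Matrix.cons_val', Matrix.cons_val_fin_one]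
  · rw [show (fun x : ℝ => (x - θ 0) / θ 1 ^ 2 * ((x - θ 0) / θ 1 ^ 2) * normalDensity θ x)
      = fun x => (1 / θ 1 ^ 4) * ((x - θ 0) ^ 2 * normalDensity θ x) by ext x; field_simp,
      integral_const_mul, m2]
    field_simp
  · rw [h01, zero_mul]
  · simp_rw [mul_comm (-1 / θ 1 + _)]
    rw [h01, zero_mul]
  · have I24 : Integrable (fun x : ℝ => (-2 / θ 1 ^ 4) * ((x - θ 0) ^ 2 * normalDensity θ x)
        + (1 / θ 1 ^ 6) * ((x - θ 0) ^ 4 * normalDensity θ x)) :=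
      (I2.const_mul _).add (I4.const_mul _)
    rw [show (fun x : ℝ => (-1 / θ 1 + (x - θ 0) ^ 2 / θ 1 ^ 3)
      * (-1 / θ 1 + (x - θ 0) ^ 2 / θ 1 ^ 3) * normalDensity θ x)
      = fun x => (1 / θ 1 ^ 2) * normalDensity θ x
        + ((-2 / θ 1 ^ 4) * ((x - θ 0) ^ 2 * normalDensity θ x)
        + (1 / θ 1 ^ 6) * ((x - θ 0) ^ 4 * normalDensity θ x)) by ext x; field_simp; ring,
      integral_add (I0.const_mul _) I24,
      integral_add (I2.const_mul _) (I4.const_mul _), integral_const_mul, integral_const_mul,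
      integral_const_mul, m0, m2, m4]
    field_simp
    ring

theorem partialDeriv_fisherMetric_normalDensity {θ : Fin 2 → ℝ} (hθ : θ ∈ normalDomain)
    (i j l : Fin 2) :
    partialDeriv i (fun η => fisherMetric normalDensity η j l) θ
      = !![1, 0; 0, 2] j l * (![0, 1] i * (-2 / θ 1 ^ 3)) := by
  have hσ : (0 : ℝ) < θ 1 := hθ
  rw [partialDeriv_congr_of_isOpen isOpen_normalDomain (fun η hη => congrFun (congrFun (fisherMetric_normalDensity hη) j) l) hθ]
  refine HasDerivAt.deriv ?_
  simp only [Matrix.of_apply]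
  refine HasDerivAt.const_mul _ ?_
  have hy : HasDerivAt (fun t : ℝ => (θ + t • (Pi.single i 1 : Fin 2 → ℝ)) 1) (![0, 1] i) 0 := by
    have h := ((hasDerivAt_id (0 : ℝ)).mul_const ((Pi.single i (1 : ℝ) : Fin 2 → ℝ) 1)).const_add
      (θ 1)
    refine h.congr_deriv ?_
    fin_cases i <;> simp
  have h := (hy.pow 2).inv (by simpa using hσ.ne')
  refine h.congr_deriv ?_
  simp
  field_simp

theorem inv_fisherMetric_normalDensity {θ : Fin 2 → ℝ} (hθ : θ ∈ normalDomain) :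
    (fisherMetric normalDensity θ)⁻¹ = !![θ 1 ^ 2, 0; 0, θ 1 ^ 2 / 2] := by
  have hσ : (0 : ℝ) < θ 1 := hθ
  rw [fisherMetric_normalDensity hθ]
  refine Matrix.inv_eq_right_inv ?_
  ext i j
  fin_cases i <;> fin_cases j <;> simp [Matrix.mul_apply, Fin.sum_univ_two, hσ.ne']
  field_simp

/-- With `christoffel_normal_one`, the transport equation for velocity `a` has matrix `(a₁ I + a₀ J)
/ σ`, where `J = !![0, 1; -1/2, 0]` is skew for `diag(1, 2)`. The scalar part rescales with `σ`; the
skew part rotates. -/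
theorem christoffel_normal_zero {θ : Fin 2 → ℝ} (hθ : θ ∈ normalDomain) (a v : Fin 2 → ℝ) :
    -∑ i, ∑ j, christoffel (fisherMetric normalDensity) θ 0 i j * a i * v j
      = (a 0 * v 1 + a 1 * v 0) / θ 1 := by
  have hσ : (0 : ℝ) < θ 1 := hθ
  simp [christoffel, Fin.sum_univ_two, inv_fisherMetric_normalDensity hθ,
    partialDeriv_fisherMetric_normalDensity hθ]
  field_simp
  ring

theorem christoffel_normal_one {θ : Fin 2 → ℝ} (hθ : θ ∈ normalDomain) (a v : Fin 2 → ℝ) :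
    -∑ i, ∑ j, christoffel (fisherMetric normalDensity) θ 1 i j * a i * v j
      = (a 1 * v 1 - a 0 * v 0 / 2) / θ 1 := by
  have hσ : (0 : ℝ) < θ 1 := hθ
  simp [christoffel, Fin.sum_univ_two, inv_fisherMetric_normalDensity hθ,
    partialDeriv_fisherMetric_normalDensity hθ]
  field_simp
  ring

/-! ### Invariants of parallel transport -/

/-- The extra singleton is there for `m = 0`, where the union is empty. -/
theorem Icc_subset_iUnion_Icc {m : ℕ} (t : Fin (m + 1) → ℝ) :
    Set.Icc (t 0) (t (Fin.last m)) ⊆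
      {t (Fin.last m)} ∪ ⋃ i : Fin m, Set.Icc (t i.castSucc) (t i.succ) := by
  induction m with
  | zero =>
    intro s hs
    exact Or.inl (le_antisymm hs.2 hs.1)
  | succ m ih =>
    intro s hs
    right
    rcases le_total (t (Fin.last m).castSucc) s with h | h
    · exact Set.mem_iUnion.2 ⟨Fin.last m, h, hs.2⟩
    · rcases ih (fun i => t i.castSucc) ⟨hs.1, h⟩ with h' | h'
      · obtain rfl : s = t (Fin.last m).castSucc := h'
        exact Set.mem_iUnion.2 ⟨Fin.last m, le_rfl, hs.2⟩
      · obtain ⟨i, hi⟩ := Set.mem_iUnion.1 h'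
        exact Set.mem_iUnion.2 ⟨i.castSucc, hi.1, hi.2⟩

theorem IsPiecewiseSmooth.cover {n : ℕ} {γ : ℝ → Fin n → ℝ} (hγ : IsPiecewiseSmooth γ) :
    ∃ (m : ℕ) (t : Fin (m + 1) → ℝ),
      Set.Icc 0 1 ⊆ ⋃ i : Fin m, Set.Icc (t i.castSucc) (t i.succ) ∧
      ∀ i : Fin m, ContDiffOn ℝ ∞ γ (Set.Icc (t i.castSucc) (t i.succ)) := by
  obtain ⟨m, t, ht, h0, h1, hs⟩ := hγ
  refine ⟨m, t, ?_, hs⟩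
  intro s hst
  rw [← h0, ← h1] at hst
  rcases Icc_subset_iUnion_Icc t hst with h | h
  · obtain rfl : s = t (Fin.last m) := h
    cases m with
    | zero => exact absurd (h0.symm.trans h1) zero_ne_one
    | succ m =>
      exact Set.mem_iUnion.2 ⟨Fin.last m, ht.monotone (Fin.castSucc_lt_succ).le, le_rfl⟩
  · exact h

theorem IsPiecewiseSmooth.continuousOn {n : ℕ} {γ : ℝ → Fin n → ℝ} (hγ : IsPiecewiseSmooth γ) :
    ContinuousOn γ (Set.Icc 0 1) := by
  obtain ⟨m, t, hc, hs⟩ := hγ.cover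
  exact ((locallyFinite_of_finite _).continuousOn_iUnion (fun _ => isClosed_Icc)
    fun i => (hs i).continuousOn).mono hc

theorem IsPiecewiseSmooth.differentiableAt {n : ℕ} {γ : ℝ → Fin n → ℝ}
    (hγ : IsPiecewiseSmooth γ) :
    ∃ S : Set ℝ, S.Finite ∧ ∀ t ∈ Set.Ioo (0 : ℝ) 1 \ S, DifferentiableAt ℝ γ t := by
  obtain ⟨m, t, hc, hs⟩ := hγ.cover
  refine ⟨Set.range t, Set.finite_range t, fun s hst => ?_⟩
  obtain ⟨i, hi⟩ := Set.mem_iUnion.1 (hc ⟨hst.1.1.le, hst.1.2.le⟩)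
  have hl : t i.castSucc < s := lt_of_le_of_ne hi.1 fun h => hst.2 ⟨_, h⟩
  have hr : s < t i.succ := lt_of_le_of_ne hi.2 fun h => hst.2 ⟨_, h.symm⟩
  exact ((hs i).contDiffAt (Icc_mem_nhds hl hr)).differentiableAt (by simp)

/-- The fundamental theorem of calculus tolerates a countable exceptional set when `f` is
continuous; this absorbs the corners of the curve. -/
theorem eq_of_hasDerivAt_zero_off_finite {f : ℝ → ℝ} (hf : ContinuousOn f (Set.Icc 0 1))
    {S : Set ℝ} (hS : S.Finite) (h : ∀ t ∈ Set.Ioo (0 : ℝ) 1 \ S, HasDerivAt f 0 t) :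
    f 1 = f 0 := by
  have := integral_eq_of_hasDerivAt_off_countable_of_le f (fun _ => 0) zero_le_one
    hS.countable hf h (by simp)
  simp only [intervalIntegral.integral_zero] at this
  linarith

/-- Parallel transport in the half-plane of normal distributions preserves the metric and the
area form. -/
theorem parallel_invariants {γ V W : ℝ → Fin 2 → ℝ} (hγ : IsPiecewiseSmooth γ)
    (hmem : ∀ t ∈ Set.Icc (0 : ℝ) 1, γ t ∈ normalDomain)
    (hV : IsParallelAlong (christoffel (fisherMetric normalDensity)) γ V)
    (hW : IsParallelAlong (christoffel (fisherMetric normalDensity)) γ W) :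
    (V 1 0 * W 1 0 + 2 * (V 1 1 * W 1 1)) / γ 1 1 ^ 2
        = (V 0 0 * W 0 0 + 2 * (V 0 1 * W 0 1)) / γ 0 1 ^ 2 ∧
      (V 1 0 * W 1 1 - V 1 1 * W 1 0) / γ 1 1 ^ 2
        = (V 0 0 * W 0 1 - V 0 1 * W 0 0) / γ 0 1 ^ 2 := by
  obtain ⟨hVc, S, hS, hVd⟩ := hV
  obtain ⟨hWc, T, hT, hWd⟩ := hW
  obtain ⟨U, hU, hγd⟩ := hγ.differentiableAt
  have hcont : ∀ {X : ℝ → Fin 2 → ℝ}, ContinuousOn X (Set.Icc 0 1) → ∀ k,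
      ContinuousOn (fun t => X t k) (Set.Icc 0 1) := fun hX k => continuousOn_pi.1 hX k
  have hne : ∀ t ∈ Set.Icc (0 : ℝ) 1, γ t 1 ^ 2 ≠ 0 := fun t ht =>
    pow_ne_zero 2 (ne_of_gt (hmem t ht))
  have hy := (hcont hγ.continuousOn 1).pow 2
  have hST : (S ∪ T ∪ U).Finite := (hS.union hT).union hU
  have hd : ∀ t ∈ Set.Ioo (0 : ℝ) 1 \ (S ∪ T ∪ U), 0 < γ t 1 ∧ ∃ a : Fin 2 → ℝ,
      HasDerivAt (fun s => γ s 1) (a 1) t ∧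
      HasDerivAt (fun s => V s 0) ((a 0 * V t 1 + a 1 * V t 0) / γ t 1) t ∧
      HasDerivAt (fun s => V s 1) ((a 1 * V t 1 - a 0 * V t 0 / 2) / γ t 1) t ∧
      HasDerivAt (fun s => W s 0) ((a 0 * W t 1 + a 1 * W t 0) / γ t 1) t ∧
      HasDerivAt (fun s => W s 1) ((a 1 * W t 1 - a 0 * W t 0 / 2) / γ t 1) t := by
    rintro t ⟨ht, hn⟩
    simp only [Set.mem_union, not_or] at hn
    have hm := hmem t ⟨ht.1.le, ht.2.le⟩
    have hz := christoffel_normal_zero hm (fun i => deriv (fun s => γ s i) t)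
    have ho := christoffel_normal_one hm (fun i => deriv (fun s => γ s i) t)
    exact ⟨hm, fun i => deriv (fun s => γ s i) t,
      (differentiableAt_pi.1 (hγd t ⟨ht, hn.2⟩) 1).hasDerivAt,
      (hVd t ⟨ht, hn.1.1⟩ 0).congr_deriv (hz _), (hVd t ⟨ht, hn.1.1⟩ 1).congr_deriv (ho _),
      (hWd t ⟨ht, hn.1.2⟩ 0).congr_deriv (hz _), (hWd t ⟨ht, hn.1.2⟩ 1).congr_deriv (ho _)⟩
  constructor
  · refine eq_of_hasDerivAt_zero_off_finite
      (f := fun t => (V t 0 * W t 0 + 2 * (V t 1 * W t 1)) / γ t 1 ^ 2)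
      (((((hcont hVc 0).mul (hcont hWc 0)).add
        (((hcont hVc 1).mul (hcont hWc 1)).const_smul (2 : ℝ))).div hy hne)) hST
      fun t ht => ?_
    obtain ⟨hpos, a, hy', hV0, hV1, hW0, hW1⟩ := hd t ht
    refine (((hV0.mul hW0).add ((hV1.mul hW1).const_mul 2)).div (hy'.pow 2)
      (pow_ne_zero 2 hpos.ne')).congr_deriv ?_
    simp [hpos.ne']
    field_simp
    ring
  -- The transport matrix has trace `2 σ'/σ`, which is the logarithmic derivative of the denominator
  -- `σ²`.
  · refine eq_of_hasDerivAt_zero_off_finite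
      (f := fun t => (V t 0 * W t 1 - V t 1 * W t 0) / γ t 1 ^ 2)
      ((((hcont hVc 0).mul (hcont hWc 1)).sub ((hcont hVc 1).mul (hcont hWc 0))).div hy hne) hST
      fun t ht => ?_
    obtain ⟨hpos, a, hy', hV0, hV1, hW0, hW1⟩ := hd t ht
    refine (((hV0.mul hW1).sub (hV1.mul hW0)).div (hy'.pow 2)
      (pow_ne_zero 2 hpos.ne')).congr_deriv ?_
    simp [hpos.ne']
    field_simp
    ring

theorem holonomy_entries {θ : Fin 2 → ℝ} (hθ : θ ∈ normalDomain) {P : GL (Fin 2) ℝ}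
    (hP : P ∈ riemannianHolonomy normalDomain (fisherMetric normalDensity) θ) :
    (P : Matrix (Fin 2) (Fin 2) ℝ)ᵀ * !![1, 0; 0, 2] * (P : Matrix (Fin 2) (Fin 2) ℝ)
        = !![1, 0; 0, 2] ∧
      (P : Matrix (Fin 2) (Fin 2) ℝ).det = 1 := by
  obtain ⟨γ, hγ, hP⟩ := hP
  have hσ : (θ 1) ^ 2 ≠ 0 := pow_ne_zero 2 (ne_of_gt hθ)
  obtain ⟨V, hV, hV0, hV1⟩ := hP ![1, 0]
  obtain ⟨W, hW, hW0, hW1⟩ := hP ![0, 1]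
  have key := fun {V W : ℝ → Fin 2 → ℝ} => parallel_invariants (V := V) (W := W)
    hγ.piecewiseSmooth hγ.mem
  simp only [hγ.source, hγ.target, div_left_inj' hσ] at key
  have hVV := (key hV hV).1
  have hWW := (key hW hW).1
  obtain ⟨hVW, hA⟩ := key hV hW
  simp [hV0, hV1, hW0, hW1, Matrix.mulVec, dotProduct, Fin.sum_univ_two] at hVV hWW hVW hA
  refine ⟨?_, by rw [Matrix.det_fin_two]; linarith⟩
  ext i j
  fin_cases i <;> fin_cases j <;> simp [Matrix.mul_apply, Fin.sum_univ_two] <;> linarith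

/-! ### Realizing rotations -/

theorem exists_cos_sin_eq {a s : ℝ} (h : a ^ 2 + s ^ 2 = 1) :
    ∃ α : ℝ, Real.cos α = a ∧ Real.sin α = s := by
  have hn : ‖(⟨a, s⟩ : ℂ)‖ = 1 := by
    rw [Complex.norm_def, Complex.normSq_mk, ← sq, ← sq, h, Real.sqrt_one]
  refine ⟨Complex.arg ⟨a, s⟩, ?_, ?_⟩
  · rw [Complex.cos_arg (norm_ne_zero_iff.1 (by rw [hn]; exact one_ne_zero)), hn, div_one]
  · rw [Complex.sin_arg, hn, div_one]

/-- The field along `γ` that starts at `v` and turns by `-φ` in the moving orthogonal frame. -/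
noncomputable def rotatingField (γ : ℝ → Fin 2 → ℝ) (φ : ℝ → ℝ) (v : Fin 2 → ℝ) (t : ℝ) :
    Fin 2 → ℝ :=
  ![γ t 1 / γ 0 1 * (Real.cos (φ t) * v 0 + √2 * Real.sin (φ t) * v 1),
    γ t 1 / γ 0 1 * (Real.cos (φ t) * v 1 - Real.sin (φ t) / √2 * v 0)]

theorem isParallelAlong_rotatingField {γ γ' : ℝ → Fin 2 → ℝ} {φ : ℝ → ℝ}
    (hmem : ∀ t ∈ Set.Icc (0 : ℝ) 1, γ t ∈ normalDomain)
    (hγ : ∀ t ∈ Set.Icc (0 : ℝ) 1, ∀ i, HasDerivAt (fun s => γ s i) (γ' t i) t)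
    (hφ : ∀ t ∈ Set.Icc (0 : ℝ) 1, HasDerivAt φ (γ' t 0 / (√2 * γ t 1)) t) (v : Fin 2 → ℝ) :
    IsParallelAlong (christoffel (fisherMetric normalDensity)) γ (rotatingField γ φ v) := by
  have h0 : (0 : ℝ) < γ 0 1 := hmem 0 ⟨le_rfl, zero_le_one⟩
  have h2 : (√2 : ℝ) ^ 2 = 2 := Real.sq_sqrt zero_le_two
  have hs2 : (0 : ℝ) < √2 := by positivity
  have hd : ∀ t ∈ Set.Icc (0 : ℝ) 1, ∀ k, HasDerivAt (fun s => rotatingField γ φ v s k)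
      (-∑ i, ∑ j, christoffel (fisherMetric normalDensity) (γ t) k i j
        * deriv (fun s => γ s i) t * rotatingField γ φ v t j) t := by
    intro t ht k
    have hpos : (0 : ℝ) < γ t 1 := hmem t ht
    simp only [fun i => (hγ t ht i).deriv]
    have hy := (hγ t ht 1).div_const (γ 0 1)
    have hc := (hφ t ht).cos
    have hs := (hφ t ht).sin
    fin_cases k
    · refine (hy.mul ((hc.mul_const (v 0)).add
        ((hs.const_mul √2).mul_const (v 1)))).congr_deriv ?_
      refine Eq.trans ?_ (christoffel_normal_zero (hmem t ht) (γ' t) _).symm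
      simp [rotatingField]
      field_simp
      ring
    · refine (hy.mul ((hc.mul_const (v 1)).sub
        ((hs.div_const √2).mul_const (v 0)))).congr_deriv ?_
      refine Eq.trans ?_ (christoffel_normal_one (hmem t ht) (γ' t) _).symm
      simp [rotatingField]
      field_simp
      linear_combination (Real.cos (φ t) * v 0 * γ' t 0
        + √2 * v 1 * Real.sin (φ t) * γ' t 0) * h2
  refine ⟨continuousOn_pi.2 fun k t ht => (hd t ht k).continuousAt.continuousWithinAt, ∅,
    Set.finite_empty, fun t ht => hd t ⟨ht.1.1.le, ht.1.2.le⟩⟩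

/-- A smooth loop in the half-plane whose holonomy is the rotation by `α`. -/
noncomputable def rotationLoop (θ : Fin 2 → ℝ) (α : ℝ) (t : ℝ) : Fin 2 → ℝ :=
  ![θ 0 - 60 * √2 * α * θ 1 * (t * (1 - t)), θ 1 / (1 + t ^ 2 * (1 - t))]

noncomputable def rotationLoopVelocity (θ : Fin 2 → ℝ) (α : ℝ) (t : ℝ) : Fin 2 → ℝ :=
  ![-(60 * √2 * α * θ 1 * (1 - 2 * t)),
    -(θ 1 * (2 * t - 3 * t ^ 2)) / (1 + t ^ 2 * (1 - t)) ^ 2]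

/-- The primitive, zero at `0`, of `μ' / (√2 σ) = -60 α (1 - 2t)(1 + t²(1 - t))`. Over `[0, 1]` the
factor `1 - 2t` integrates to `0` and `(1 - 2t) t² (1 - t)` to `1/3 - 3/4 + 2/5 = -1/60`; hence the
constant `60`, making the total angle `α`. -/
noncomputable def rotationLoopAngle (α : ℝ) (t : ℝ) : ℝ :=
  -(60 * α) * (t - t ^ 2 + t ^ 3 / 3 - 3 / 4 * t ^ 4 + 2 / 5 * t ^ 5)

theorem one_add_sq_mul_one_sub_pos {t : ℝ} (ht : t ∈ Set.Icc (0 : ℝ) 1) :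
    0 < 1 + t ^ 2 * (1 - t) := by
  have := mul_nonneg (sq_nonneg t) (sub_nonneg.2 ht.2)
  linarith

theorem isLoopAt_rotationLoop {θ : Fin 2 → ℝ} (hθ : θ ∈ normalDomain) (α : ℝ) :
    IsLoopAt normalDomain θ (rotationLoop θ α) where
  piecewiseSmooth := by
    refine ⟨1, ![0, 1], ?_, rfl, rfl, fun i => ?_⟩
    · intro i j hij
      fin_cases i <;> fin_cases j <;> simp_all
    · fin_cases i
      refine contDiffOn_pi.2 fun k => ?_
      fin_cases k
      · exact ContDiff.contDiffOn (f := fun t : ℝ => θ 0 - 60 * √2 * α * θ 1 * (t * (1 - t)))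
          (by fun_prop)
      · exact ContDiffOn.div (f := fun _ : ℝ => θ 1) (g := fun t : ℝ => 1 + t ^ 2 * (1 - t))
          (by fun_prop) (by fun_prop) fun t ht => (one_add_sq_mul_one_sub_pos ht).ne'
  mem t ht := div_pos hθ (one_add_sq_mul_one_sub_pos ht)
  source := by ext i; fin_cases i <;> simp [rotationLoop]
  target := by ext i; fin_cases i <;> simp [rotationLoop]

theorem hasDerivAt_rotationLoop (θ : Fin 2 → ℝ) (α : ℝ) {t : ℝ} (ht : t ∈ Set.Icc (0 : ℝ) 1)
    (i : Fin 2) :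
    HasDerivAt (fun s => rotationLoop θ α s i) (rotationLoopVelocity θ α t i) t := by
  have hi := hasDerivAt_id t
  have h1 := hi.const_sub 1
  fin_cases i
  · refine (((hi.mul h1).const_mul (60 * √2 * α * θ 1)).const_sub (θ 0)).congr_deriv ?_
    simp [rotationLoopVelocity]
    left
    ring
  · refine ((hasDerivAt_const t (θ 1)).div (((hi.pow 2).mul h1).const_add 1)
      (one_add_sq_mul_one_sub_pos ht).ne').congr_deriv ?_
    simp [rotationLoopVelocity]
    ring

theorem hasDerivAt_rotationLoopAngle {θ : Fin 2 → ℝ} (hθ : θ ∈ normalDomain) (α : ℝ) {t : ℝ}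
    (ht : t ∈ Set.Icc (0 : ℝ) 1) :
    HasDerivAt (rotationLoopAngle α)
      (rotationLoopVelocity θ α t 0 / (√2 * rotationLoop θ α t 1)) t := by
  have hσ : (0 : ℝ) < θ 1 := hθ
  have hq := one_add_sq_mul_one_sub_pos ht
  have hs2 : (0 : ℝ) < √2 := by positivity
  have hi := hasDerivAt_id t
  refine ((((((hi.sub (hi.pow 2)).add ((hi.pow 3).div_const 3)).sub
    ((hi.pow 4).const_mul (3 / 4))).add ((hi.pow 5).const_mul (2 / 5)))).const_mul
    (-(60 * α))).congr_deriv ?_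
  simp [rotationLoopVelocity, rotationLoop]
  field_simp
  ring

theorem mem_holonomy_of_entries {θ : Fin 2 → ℝ} (hθ : θ ∈ normalDomain) {P : GL (Fin 2) ℝ}
    (hG : (P : Matrix (Fin 2) (Fin 2) ℝ)ᵀ * !![1, 0; 0, 2] * (P : Matrix (Fin 2) (Fin 2) ℝ)
        = !![1, 0; 0, 2])
    (hdet : (P : Matrix (Fin 2) (Fin 2) ℝ).det = 1) :
    P ∈ riemannianHolonomy normalDomain (fisherMetric normalDensity) θ := by
  have hσ : (0 : ℝ) < θ 1 := hθ
  have h2 : (√2 : ℝ) ^ 2 = 2 := Real.sq_sqrt zero_le_two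
  have hs2 : (0 : ℝ) < √2 := by positivity
  have e00 := congrFun (congrFun hG 0) 0
  have e01 := congrFun (congrFun hG 0) 1
  have e11 := congrFun (congrFun hG 1) 1
  rw [Matrix.det_fin_two] at hdet
  simp [Matrix.mul_apply, Fin.sum_univ_two] at e00 e01 e11
  set a := (P : Matrix (Fin 2) (Fin 2) ℝ) 0 0 with ha
  set b := (P : Matrix (Fin 2) (Fin 2) ℝ) 0 1 with hb
  set c := (P : Matrix (Fin 2) (Fin 2) ℝ) 1 0 with hc
  set d := (P : Matrix (Fin 2) (Fin 2) ℝ) 1 1 with hd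
  -- An isometry of `diag(1, 2)` with determinant one has the form `!![a, -2c; c, a]` with `a² + 2c²
  -- = 1`.
  have hda : d = a := by linear_combination (-d) * e00 + c * e01 + a * hdet
  have hbc : b = -(2 * c) := by linear_combination (-b) * e00 + a * e01 - 2 * c * hdet
  -- The first column of the transport by angle `α` is `(cos α, -sin α / √2)`, which forces these
  -- values.
  obtain ⟨α, hcos, hsin⟩ := exists_cos_sin_eq (a := a) (s := -(√2 * c)) (by
    rw [neg_sq, mul_pow, h2]; linarith)
  refine ⟨rotationLoop θ α, isLoopAt_rotationLoop hθ α, fun v =>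
    ⟨rotatingField (rotationLoop θ α) (rotationLoopAngle α) v,
      isParallelAlong_rotatingField (isLoopAt_rotationLoop hθ α).mem
        (fun t ht => hasDerivAt_rotationLoop θ α ht)
        (fun t ht => hasDerivAt_rotationLoopAngle hθ α ht) v, ?_, ?_⟩⟩
  · ext i
    fin_cases i <;> simp [rotatingField, rotationLoopAngle, rotationLoop, hσ.ne']
  · have hone : rotationLoopAngle α 1 = α := by
      rw [rotationLoopAngle]; ring
    ext i
    fin_cases i
    · simp [rotatingField, hone, rotationLoop, hσ.ne', hcos, hsin, Matrix.mulVec, dotProduct,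
        Fin.sum_univ_two, ← ha, ← hb]
      linear_combination (-c * v 1) * h2 - v 1 * hbc
    · simp [rotatingField, hone, rotationLoop, hσ.ne', hcos, hsin, Matrix.mulVec, dotProduct,
        Fin.sum_univ_two, ← hc, ← hd]
      field_simp
      linear_combination (- v 1) * hda

/-! ### Holonomy as the special isometry group of `g`, and orthonormal frames -/

theorem mem_holonomy_iff {θ : Fin 2 → ℝ} (hθ : θ ∈ normalDomain) (P : GL (Fin 2) ℝ) :
    P ∈ riemannianHolonomy normalDomain (fisherMetric normalDensity) θ ↔
      (P : Matrix (Fin 2) (Fin 2) ℝ)ᵀ * fisherMetric normalDensity θ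
          * (P : Matrix (Fin 2) (Fin 2) ℝ) = fisherMetric normalDensity θ ∧
        (P : Matrix (Fin 2) (Fin 2) ℝ).det = 1 := by
  have hσ : ((θ 1) ^ 2)⁻¹ ≠ 0 := inv_ne_zero (pow_ne_zero 2 (ne_of_gt hθ))
  have hg : fisherMetric normalDensity θ = ((θ 1) ^ 2)⁻¹ • !![1, 0; 0, 2] := by
    rw [fisherMetric_normalDensity hθ]
    ext i j
    simp [mul_comm]
  rw [hg, Matrix.mul_smul, Matrix.smul_mul, smul_right_inj hσ]
  exact ⟨holonomy_entries hθ, fun h => mem_holonomy_of_entries hθ h.1 h.2⟩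

theorem exists_isOrthonormalFrame {θ : Fin 2 → ℝ} (hθ : θ ∈ normalDomain) :
    ∃ F : GL (Fin 2) ℝ, IsOrthonormalFrame (fisherMetric normalDensity) θ F := by
  have hσ : (0 : ℝ) < θ 1 := hθ
  have h2 : (√2 : ℝ) ^ 2 = 2 := Real.sq_sqrt zero_le_two
  have hs2 : (0 : ℝ) < √2 := by positivity
  refine ⟨Matrix.GeneralLinearGroup.mkOfDetNeZero !![θ 1, 0; 0, θ 1 / √2] ?_, ?_⟩
  · rw [Matrix.det_fin_two_of, mul_zero, sub_zero]
    exact (by positivity : 0 < θ 1 * (θ 1 / √2)).ne'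
  · rw [IsOrthonormalFrame, fisherMetric_normalDensity hθ]
    ext i j
    fin_cases i <;> fin_cases j <;>
      simp [Matrix.GeneralLinearGroup.mkOfDetNeZero, Matrix.mul_apply, Fin.sum_univ_two]
    · field_simp
    · field_simp
      rw [h2]

end StatHolonomy

theorem proposition5p9 (θ : Fin 2 → ℝ) (hθ : θ ∈ StatHolonomy.normalDomain) :
    (∃ F : GL (Fin 2) ℝ,
      StatHolonomy.IsOrthonormalFrame
        (StatHolonomy.fisherMetric StatHolonomy.normalDensity) θ F) ∧
    ∀ F : GL (Fin 2) ℝ,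
      StatHolonomy.IsOrthonormalFrame
        (StatHolonomy.fisherMetric StatHolonomy.normalDensity) θ F →
      (fun P : GL (Fin 2) ℝ => ((F⁻¹ * P * F : GL (Fin 2) ℝ) : Matrix (Fin 2) (Fin 2) ℝ)) ''
          StatHolonomy.riemannianHolonomy StatHolonomy.normalDomain
            (StatHolonomy.fisherMetric StatHolonomy.normalDensity) θ =
        (Matrix.specialOrthogonalGroup (Fin 2) ℝ : Set (Matrix (Fin 2) (Fin 2) ℝ)) := by
  refine ⟨StatHolonomy.exists_isOrthonormalFrame hθ, fun F hF => ?_⟩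
  set g := StatHolonomy.fisherMetric StatHolonomy.normalDensity θ with hg
  have hSO : ∀ M : GL (Fin 2) ℝ,
      (M : Matrix (Fin 2) (Fin 2) ℝ) ∈ Matrix.specialOrthogonalGroup (Fin 2) ℝ ↔
        (M : Matrix (Fin 2) (Fin 2) ℝ)ᵀ * (M : Matrix (Fin 2) (Fin 2) ℝ) = 1 ∧
          (M : Matrix (Fin 2) (Fin 2) ℝ).det = 1 := fun M => by
    rw [Matrix.mem_specialOrthogonalGroup_iff, Matrix.mem_orthogonalGroup_iff']
  have hconj : ∀ P : GL (Fin 2) ℝ,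
      P ∈ StatHolonomy.riemannianHolonomy StatHolonomy.normalDomain
          (StatHolonomy.fisherMetric StatHolonomy.normalDensity) θ ↔
        ((F⁻¹ * P * F : GL (Fin 2) ℝ) : Matrix (Fin 2) (Fin 2) ℝ) ∈
          Matrix.specialOrthogonalGroup (Fin 2) ℝ := by
    intro P
    have hPF : (F : Matrix (Fin 2) (Fin 2) ℝ) * ((F⁻¹ * P * F : GL (Fin 2) ℝ) : Matrix _ _ ℝ)
        = (P : Matrix (Fin 2) (Fin 2) ℝ) * (F : Matrix (Fin 2) (Fin 2) ℝ) := by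
      rw [← Units.val_mul, ← Units.val_mul]
      congr 1
      group
    have hdet : ((F⁻¹ * P * F : GL (Fin 2) ℝ) : Matrix (Fin 2) (Fin 2) ℝ).det
        = (P : Matrix (Fin 2) (Fin 2) ℝ).det := by
      have h := congrArg Matrix.det hPF
      rw [Matrix.det_mul, Matrix.det_mul, mul_comm] at h
      exact mul_right_cancel₀ (Matrix.GeneralLinearGroup.det_ne_zero F) h
    rw [StatHolonomy.mem_holonomy_iff hθ, hSO, hdet]
    refine and_congr_left fun _ => ?_
    generalize hM : ((F⁻¹ * P * F : GL (Fin 2) ℝ) : Matrix (Fin 2) (Fin 2) ℝ) = M at hPF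
    have hF' : (F : Matrix (Fin 2) (Fin 2) ℝ)ᵀ * g * (F : Matrix (Fin 2) (Fin 2) ℝ) = 1 := hF
    -- Inserting `Fᵀ g F = 1` and `F M = P F` turns orthogonality of `M` into invariance of `g`
    -- under `P`, after cancelling `Fᵀ` and `F`.
    have hMM : Mᵀ * M = (F : Matrix (Fin 2) (Fin 2) ℝ)ᵀ *
        ((P : Matrix (Fin 2) (Fin 2) ℝ)ᵀ * g * (P : Matrix (Fin 2) (Fin 2) ℝ)) *
          (F : Matrix (Fin 2) (Fin 2) ℝ) := by
      calc Mᵀ * M = Mᵀ * ((F : Matrix (Fin 2) (Fin 2) ℝ)ᵀ * g * F) * M := by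
            rw [hF', Matrix.mul_one]
        _ = ((F : Matrix (Fin 2) (Fin 2) ℝ) * M)ᵀ * g * ((F : Matrix (Fin 2) (Fin 2) ℝ) * M) := by
            rw [Matrix.transpose_mul]; simp only [Matrix.mul_assoc]
        _ = _ := by
            rw [hPF, Matrix.transpose_mul]; simp only [Matrix.mul_assoc]
    rw [hMM, ← hF']
    have hFu : IsUnit (F : Matrix (Fin 2) (Fin 2) ℝ) := F.isUnit
    have hFt : IsUnit (F : Matrix (Fin 2) (Fin 2) ℝ)ᵀ := (Matrix.isUnit_transpose _).2 hFu
    rw [hFu.mul_left_inj, hFt.mul_right_inj]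
  ext M
  constructor
  · rintro ⟨P, hP, rfl⟩
    exact (hconj P).1 hP
  · intro hM
    have hM' : M ∈ Matrix.specialOrthogonalGroup (Fin 2) ℝ := hM
    have hdet : M.det ≠ 0 := by
      rw [(Matrix.mem_specialOrthogonalGroup_iff.1 hM').2]
      exact one_ne_zero
    let N : GL (Fin 2) ℝ := Matrix.GeneralLinearGroup.mkOfDetNeZero M hdet
    have hN : F⁻¹ * (F * N * F⁻¹) * F = N := by group
    have hNM : ((F⁻¹ * (F * N * F⁻¹) * F : GL (Fin 2) ℝ) : Matrix (Fin 2) (Fin 2) ℝ) = M := by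
      rw [hN]
      rfl
    exact ⟨F * N * F⁻¹, (hconj _).2 (by rw [hNM]; exact hM'), hNM⟩
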